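/- Let $G$ be a finite simple graph with an even number of vertices, drawn in the plane without crossings (vertices are distinct points, edges are simple arcs joining their ends and meeting vertices and other edges only at common ends), and let every edge $e$ carry a weight $\omega_e$ in a commutative ring (for instance a real number). For a weighted graph $H$ let $M(H)$ be the sum, over all perfect matchings of $H$, of the product of the weights of the edges of the matching; the graph without vertices has one perfect matching, of weight $1$. Deleting a vertex removes it together with its incident edges; deleting an edge keeps all vertices; the remaining weights are unchanged. Let $a_1, b_1$ be vertices of $G$ and let $e=a_2b_2$ be an edge of $G$, such that the four vertices $a_1,b_1,a_2,b_2$ are distinct and appear in this cyclic order on the boundary of a face $F$ of $G$; that is, there is a closed topological disc contained in $F$ except for four points of its boundary circle, which are $a_1,b_1,a_2,b_2$ in this cyclic order (clockwise or anticlockwise). Then $$M(G)\,M(G-a_1-b_1-e)=M(G-a_1-b_1)\,M(G-e)+\omega_e\,M(G-a_1-a_2)\,M(G-b_1-b_2)-\omega_e\,M(G-a_1-b_2)\,M(G-a_2-b_1).$$ -/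

import Mathlib

/-- A simple graph on the vertex type `V` with a weight in `R` attached to every edge
(values of `weight` at pairs that are not edges play no role). -/
structure WeightedGraph (V : Type*) (R : Type*) where
  graph : SimpleGraph V
  weight : Sym2 V → R

namespace WeightedGraph

variable {V R : Type*}

/-- The weight of a set of edges: the product of the weights of its members. -/
noncomputable def weightOf [CommRing R] (G : WeightedGraph V R) (E : Set (Sym2 V)) : R :=
  ∏ᶠ e ∈ E, G.weight e

/-- `M(G)`: the sum, over all perfect matchings of `G`, of the products of the weights of
their edges. (For finite `V`, the only case of interest, all sums and products are finite.) -/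
noncomputable def M [CommRing R] (G : WeightedGraph V R) : R :=
  ∑ᶠ P : {P : G.graph.Subgraph // P.IsPerfectMatching}, G.weightOf P.1.edgeSet

/-- `G - A` for a set `A` of vertices: the subgraph induced on the complement of `A`,
with the same weights. -/
def deleteVerts (G : WeightedGraph V R) (A : Set V) : WeightedGraph ↥(Aᶜ) R where
  graph := G.graph.induce Aᶜ
  weight := fun e => G.weight (e.map Subtype.val)

/-- `G - E` for a set `E` of edges: all vertices are kept, the edges in `E` are removed. -/
def deleteEdges (G : WeightedGraph V R) (E : Set (Sym2 V)) : WeightedGraph V R where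
  graph := G.graph.deleteEdges E
  weight := G.weight

end WeightedGraph

/-- A plane drawing of a simple graph; the plane is `ℂ`. Vertices are distinct points, every
edge is a simple arc joining its two ends, and an arc meets the vertices and the other arcs
only in ends. A dart is an edge with a chosen direction; the two directions of an edge give
the same arc, traversed in opposite senses. -/
structure PlaneDrawing {V : Type*} (G : SimpleGraph V) where
  pt : V → ℂ
  pt_injective : Function.Injective pt
  arc : ∀ d : G.Dart, Path (pt d.fst) (pt d.snd)
  arc_symm : ∀ d : G.Dart, arc d.symm = (arc d).symm
  arc_injective : ∀ d : G.Dart, Function.Injective (arc d)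
  eq_end_of_arc_eq_pt : ∀ (d : G.Dart) (t : unitInterval) (v : V),
    arc d t = pt v → v ∈ d.edge
  eq_pt_of_arc_eq_arc : ∀ d d' : G.Dart, d.edge ≠ d'.edge → ∀ t t' : unitInterval,
    arc d t = arc d' t' → ∃ v : V, v ∈ d.edge ∧ v ∈ d'.edge ∧ arc d t = pt v

namespace PlaneDrawing

variable {V : Type*} {G : SimpleGraph V}

/-- The set of all points of the plane that lie on the drawing. -/
def support (D : PlaneDrawing G) : Set ℂ :=
  Set.range D.pt ∪ ⋃ d : G.Dart, Set.range (D.arc d)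

/-- The faces of the drawing: the connected components of its complement in the plane. -/
def IsFace (D : PlaneDrawing G) (F : Set ℂ) : Prop :=
  ∃ x ∈ D.supportᶜ, F = connectedComponentIn D.supportᶜ x

/-- The four vertices `a, b, c, d` appear in this cyclic order (clockwise or anticlockwise) on
the face `F`: there is a closed topological disc that lies in `F` except for four points of its
boundary circle, which are, in cyclic order, the vertices `a, b, c, d`. (Cyclically ordered
points of the circle can be moved to `1, i, -1, -i` by a homeomorphism of the disc.)
In particular the four vertices are distinct and lie on the boundary of `F`. The definition
makes sense also when the boundary of `F` is not a cycle of the graph: for a connected graph it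
says that the closed walk along the boundary of `F` visits the vertices in this cyclic order. -/
def CyclicOrderOnFace (D : PlaneDrawing G) (F : Set ℂ) (a b c d : V) : Prop :=
  ∃ φ : ℂ → ℂ,
    ContinuousOn φ (Metric.closedBall 0 1) ∧
    Set.InjOn φ (Metric.closedBall 0 1) ∧
    φ 1 = D.pt a ∧ φ Complex.I = D.pt b ∧ φ (-1) = D.pt c ∧ φ (-Complex.I) = D.pt d ∧
    ∀ z ∈ Metric.closedBall (0 : ℂ) 1,
      z ∉ ({1, Complex.I, -1, -Complex.I} : Set ℂ) → φ z ∈ F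

end PlaneDrawing

/- Splitting the matchings according to whether they contain `e` turns the identity into Kuo's
condensation for the vertices `a₁, b₁, a₂, b₂`. To prove the latter, superpose two matchings that
together miss each of these four vertices exactly once. The superposition is a disjoint union of
alternating cycles and paths, and the four vertices are the ends of two paths. Exchanging the two
matchings outside the component of `a₁` preserves the product of the weights, and it moves `a₂` from
the vertices missed by one matching to those missed by the other, provided that the path from `a₁`
does not end at `a₂`. If it did, the other path would join `b₁` to `b₂` and be disjoint from it.

Such disjoint paths `p` and `q` are excluded by winding numbers. If two paths `f` and `g` do not
meet, then `f s - g t` winds `0` times around the origin along the boundary of the unit square. Let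
`f` be `p` or the image of one diameter of the disc, and `g` be `q` or the image of the other
diameter. As the two choices for `f` have the same ends, and so have those for `g`, a signed sum of
the four winding numbers vanishes. Disjointness makes three of them zero, hence also the one for the
two diameters. But on the boundary of the square this last difference can be deformed, without
zeros, to an odd map, whose winding number is odd. -/

section LogChange

open scoped unitInterval

theorem exists_continuous_log {X : Type*} [TopologicalSpace X] [SimplyConnectedSpace X]
    [LocallyPathConnectedSpace X] {f : X → ℂ} (hf : Continuous f) (h0 : ∀ x, f x ≠ 0) :
    ∃ l : X → ℂ, Continuous l ∧ ∀ x, Complex.exp (l x) = f x := by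
  obtain ⟨x₀⟩ := (inferInstance : Nonempty X)
  obtain ⟨l, ⟨-, hl⟩, -⟩ := Complex.isCoveringMapOn_exp.existsUnique_continuousMap_lifts
    ⟨f, hf⟩ (Complex.exp_log (h0 x₀)) h0
  exact ⟨l, l.continuous, congrFun hl⟩

instance contractibleSpace_unitInterval : ContractibleSpace I :=
  (convex_Icc 0 1).contractibleSpace ⟨0, by simp⟩

instance locallyPathConnectedSpace_unitInterval : LocallyPathConnectedSpace I :=
  (convex_Icc 0 1).locallyPathConnectedSpace

open Classical in
/-- The change of a continuous logarithm along a path in the punctured plane, that is, `2πi` times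
the winding number around `0` when the path is closed. The value is `0` if the path has no
continuous logarithm. -/
noncomputable def logChange (γ : I → ℂ) : ℂ :=
  if h : ∃ l : I → ℂ, Continuous l ∧ ∀ t, Complex.exp (l t) = γ t then
    h.choose 1 - h.choose 0 else 0

theorem logChange_eq {γ l : I → ℂ} (hl : Continuous l) (h : ∀ t, Complex.exp (l t) = γ t) :
    logChange γ = l 1 - l 0 := by
  have hex : ∃ l : I → ℂ, Continuous l ∧ ∀ t, Complex.exp (l t) = γ t := ⟨l, hl, h⟩
  rw [logChange, dif_pos hex]
  obtain ⟨hm, hexp⟩ := hex.choose_spec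
  set m := hex.choose
  have hshift : Complex.exp (l 0 - m 0) = 1 := by
    rw [Complex.exp_sub, h, hexp, div_self (h 0 ▸ Complex.exp_ne_zero _)]
  have hml : (fun t => m t + (l 0 - m 0)) = l := by
    refine Complex.isCoveringMap_exp.eq_of_comp_eq (by fun_prop) hl ?_ 0 (by ring)
    ext t
    simp [Complex.exp_add, hshift, hexp, h]
  linear_combination congrFun hml 1

theorem exp_logChange {γ : I → ℂ} (hγ : Continuous γ) (h0 : ∀ t, γ t ≠ 0) :
    Complex.exp (logChange γ) = γ 1 / γ 0 := by
  obtain ⟨l, hl, h⟩ := exists_continuous_log hγ h0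
  rw [logChange_eq hl h, Complex.exp_sub, h, h]

theorem logChange_neg_comp_symm {γ : I → ℂ} (hγ : Continuous γ) (h0 : ∀ t, γ t ≠ 0) :
    logChange (fun t => -γ (σ t)) = -logChange γ := by
  obtain ⟨l, hl, h⟩ := exists_continuous_log hγ h0
  have hneg : ∀ t, Complex.exp (l (σ t) + Real.pi * Complex.I) = -γ (σ t) := fun t => by
    simp [Complex.exp_add, h]
  rw [logChange_eq hl h, logChange_eq (by fun_prop) hneg, unitInterval.symm_zero,
    unitInterval.symm_one]
  ring

/-- The change of a continuous logarithm of `f` around the boundary of the unit square,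
counterclockwise: `2πi` times the winding number of `f` on the boundary. -/
noncomputable def boundaryLogChange (f : I → I → ℂ) : ℂ :=
  logChange (fun s => f s 0) + logChange (fun t => f 1 t)
    - logChange (fun s => f s 1) - logChange (fun t => f 0 t)

theorem boundaryLogChange_eq_zero {f : I → I → ℂ} (hf : Continuous fun p : I × I => f p.1 p.2)
    (h0 : ∀ s t, f s t ≠ 0) : boundaryLogChange f = 0 := by
  obtain ⟨l, hl, h⟩ := exists_continuous_log hf fun p => h0 p.1 p.2
  rw [boundaryLogChange, logChange_eq (l := fun s => l (s, 0)) (by fun_prop) fun s => h (s, 0),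
    logChange_eq (l := fun t => l (1, t)) (by fun_prop) fun t => h (1, t),
    logChange_eq (l := fun s => l (s, 1)) (by fun_prop) fun s => h (s, 1),
    logChange_eq (l := fun t => l (0, t)) (by fun_prop) fun t => h (0, t)]
  ring

theorem boundaryLogChange_eq_of_homotopy {H : I → I → I → ℂ}
    (hH : Continuous fun p : I × I × I => H p.1 p.2.1 p.2.2)
    (h0 : ∀ u s t, s = 0 ∨ s = 1 ∨ t = 0 ∨ t = 1 → H u s t ≠ 0) :
    boundaryLogChange (H 0) = boundaryLogChange (H 1) := by
  have bottom := boundaryLogChange_eq_zero (f := fun u s => H u s 0)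
    (hH.comp (by fun_prop : Continuous fun p : I × I => (p.1, p.2, (0 : I)))) (by simp [h0])
  have right := boundaryLogChange_eq_zero (f := fun u t => H u 1 t)
    (hH.comp (by fun_prop : Continuous fun p : I × I => (p.1, (1 : I), p.2))) (by simp [h0])
  have top := boundaryLogChange_eq_zero (f := fun u s => H u s 1)
    (hH.comp (by fun_prop : Continuous fun p : I × I => (p.1, p.2, (1 : I)))) (by simp [h0])
  have left := boundaryLogChange_eq_zero (f := fun u t => H u 0 t)
    (hH.comp (by fun_prop : Continuous fun p : I × I => (p.1, (0 : I), p.2))) (by simp [h0])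
  simp only [boundaryLogChange] at bottom right top left ⊢
  linear_combination top + left - bottom - right

theorem boundaryLogChange_ne_zero_of_odd {f : I → I → ℂ}
    (hf : Continuous fun p : I × I => f p.1 p.2)
    (h0 : ∀ s t, s = 0 ∨ s = 1 ∨ t = 0 ∨ t = 1 → f s t ≠ 0)
    (hodd : ∀ s t, f (σ s) (σ t) = -f s t) : boundaryLogChange f ≠ 0 := by
  intro h
  have hbottom : Continuous fun s => f s 0 :=
    hf.comp (by fun_prop : Continuous fun s : I => (s, (0 : I)))
  have hright : Continuous fun t => f 1 t :=
    hf.comp (by fun_prop : Continuous fun t : I => ((1 : I), t))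
  have htop : logChange (fun s => f s 1) = -logChange (fun s => f s 0) := by
    rw [← logChange_neg_comp_symm hbottom fun s => h0 s 0 (by simp)]
    simp [← hodd]
  have hleft : logChange (fun t => f 0 t) = -logChange (fun t => f 1 t) := by
    rw [← logChange_neg_comp_symm hright fun t => h0 1 t (by simp)]
    simp [← hodd]
  have hhalf : logChange (fun s => f s 0) + logChange (fun t => f 1 t) = 0 := by
    rw [boundaryLogChange, htop, hleft] at h
    linear_combination h / 2
  have hratio : f 1 0 / f 0 0 * (f 1 1 / f 1 0) = 1 := by
    rw [← exp_logChange hbottom fun s => h0 s 0 (by simp),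
      ← exp_logChange hright fun t => h0 1 t (by simp), ← Complex.exp_add, hhalf, Complex.exp_zero]
  have hcorner : f 1 1 = -f 0 0 := by simpa using hodd 0 0
  have h00 := h0 0 0 (by simp)
  have h10 := h0 1 0 (by simp)
  rw [hcorner] at hratio
  field_simp at hratio
  norm_num at hratio

/-- The affine coordinate on the unit interval that runs from `-1` to `1`. -/
def centered (s : I) : ℝ := 2 * s - 1

@[fun_prop]
theorem continuous_centered : Continuous centered := by
  unfold centered
  fun_prop

@[simp]
theorem centered_zero : centered 0 = -1 := by simp [centered]

@[simp]
theorem centered_one : centered 1 = 1 := by norm_num [centered]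

@[simp]
theorem centered_symm (s : I) : centered (σ s) = -centered s := by
  rw [centered, centered, unitInterval.coe_symm_eq]
  ring

theorem abs_centered_le_one (s : I) : |centered s| ≤ 1 := by
  obtain ⟨s, hs⟩ := s
  rw [centered, abs_le]
  constructor <;> linarith [hs.1, hs.2]

theorem sub_mul_midpoint_mem_closedBall {x y : ℂ} (hx : x ∈ Metric.closedBall 0 1)
    (hy : y ∈ Metric.closedBall 0 1) (u : I) :
    x - (u : ℝ) * ((x + y) / 2) ∈ Metric.closedBall 0 1 := by
  have hneg : -y ∈ Metric.closedBall 0 1 := by simpa using hy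
  have hu := u.2
  convert convex_closedBall 0 1 hx hneg (by linarith [hu.2] : 0 ≤ 1 - (u : ℝ) / 2)
    (by linarith [hu.1] : 0 ≤ (u : ℝ) / 2) (by ring) using 1
  simp only [Complex.real_smul]
  push_cast
  ring

theorem centered_mem_closedBall (s : I) : (centered s : ℂ) ∈ Metric.closedBall (0 : ℂ) 1 := by
  simpa using abs_centered_le_one s

theorem centered_mul_I_mem_closedBall (t : I) :
    (centered t * Complex.I : ℂ) ∈ Metric.closedBall (0 : ℂ) 1 := by
  simpa using abs_centered_le_one t

-- Borsuk's argument: moving the midpoint of the two points `x`, `y` of the diameters to `0` with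
-- `x - y` fixed deforms `φ x - φ y` to an odd function, without zeros where `x ≠ y`.
theorem boundaryLogChange_diameters_ne_zero {φ : ℂ → ℂ}
    (hc : ContinuousOn φ (Metric.closedBall 0 1)) (hinj : Set.InjOn φ (Metric.closedBall 0 1)) :
    boundaryLogChange (fun s t => φ (centered s) - φ (centered t * Complex.I)) ≠ 0 := by
  let x (u s t : I) : ℂ := centered s - (u : ℝ) * ((centered s + centered t * Complex.I) / 2)
  let y (u s t : I) : ℂ :=
    centered t * Complex.I - (u : ℝ) * ((centered t * Complex.I + centered s) / 2)
  let H (u s t : I) : ℂ := φ (x u s t) - φ (y u s t)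
  have hx (u s t) : x u s t ∈ Metric.closedBall 0 1 :=
    sub_mul_midpoint_mem_closedBall (centered_mem_closedBall s) (centered_mul_I_mem_closedBall t) u
  have hy (u s t) : y u s t ∈ Metric.closedBall 0 1 :=
    sub_mul_midpoint_mem_closedBall (centered_mul_I_mem_closedBall t) (centered_mem_closedBall s) u
  have hxc : Continuous fun p : I × I × I => x p.1 p.2.1 p.2.2 := by fun_prop
  have hyc : Continuous fun p : I × I × I => y p.1 p.2.1 p.2.2 := by fun_prop
  have hcont : Continuous fun p : I × I × I => H p.1 p.2.1 p.2.2 :=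
    (hc.comp_continuous hxc fun p => hx p.1 p.2.1 p.2.2).sub
      (hc.comp_continuous hyc fun p => hy p.1 p.2.1 p.2.2)
  have hne : ∀ u s t, s = 0 ∨ s = 1 ∨ t = 0 ∨ t = 1 → H u s t ≠ 0 := by
    intro u s t hst h
    have hxy : x u s t = y u s t := hinj (hx u s t) (hy u s t) (sub_eq_zero.1 h)
    have heq : (centered s : ℂ) = centered t * Complex.I := by
      linear_combination hxy
    have hs : centered s = 0 := by simpa using congrArg Complex.re heq
    have ht : centered t = 0 := by simpa using (congrArg Complex.im heq).symm
    rcases hst with rfl | rfl | rfl | rfl <;> simp at hs ht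
  have hodd : ∀ s t, H 1 (σ s) (σ t) = -H 1 s t := by
    intro s t
    have hxy : x 1 (σ s) (σ t) = y 1 s t := by
      simp only [x, y, centered_symm, Complex.ofReal_neg, Set.Icc.coe_one, Complex.ofReal_one]
      ring
    have hyx : y 1 (σ s) (σ t) = x 1 s t := by
      simp only [x, y, centered_symm, Complex.ofReal_neg, Set.Icc.coe_one, Complex.ofReal_one]
      ring
    simp only [H, hxy, hyx, neg_sub]
  have hstart : H 0 = fun s t => φ (centered s) - φ (centered t * Complex.I) := by
    simp [H, x, y]
  have hend : Continuous fun p : I × I => H 1 p.1 p.2 :=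
    hcont.comp (by fun_prop : Continuous fun p : I × I => ((1 : I), p.1, p.2))
  rw [← hstart, boundaryLogChange_eq_of_homotopy hcont hne]
  exact boundaryLogChange_ne_zero_of_odd hend (hne 1) hodd

theorem exists_eq_of_joins_antipodes {φ : ℂ → ℂ} (hc : ContinuousOn φ (Metric.closedBall 0 1))
    (hinj : Set.InjOn φ (Metric.closedBall 0 1)) (P : Path (φ (-1)) (φ 1))
    (Q : Path (φ (-Complex.I)) (φ Complex.I))
    (hP : ∀ s, ∀ z ∈ Metric.closedBall (0 : ℂ) 1, z.re = 0 → P s ≠ φ z)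
    (hQ : ∀ t, ∀ z ∈ Metric.closedBall (0 : ℂ) 1, z.im = 0 → Q t ≠ φ z) :
    ∃ s t, P s = Q t := by
  by_contra! hPQ
  let A (s : I) : ℂ := φ (centered s)
  let B (t : I) : ℂ := φ (centered t * Complex.I)
  have hA : Continuous A := hc.comp_continuous (by fun_prop) centered_mem_closedBall
  have hB : Continuous B := hc.comp_continuous (by fun_prop) centered_mul_I_mem_closedBall
  have hPB := boundaryLogChange_eq_zero (f := fun s t => P s - B t) (by fun_prop)
    fun s t => sub_ne_zero.2 (hP s _ (centered_mul_I_mem_closedBall t) (by simp))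
  have hAQ := boundaryLogChange_eq_zero (f := fun s t => A s - Q t) (by fun_prop)
    fun s t => sub_ne_zero.2 (hQ t _ (centered_mem_closedBall s) (by simp)).symm
  have hPQ := boundaryLogChange_eq_zero (f := fun s t => P s - Q t) (by fun_prop)
    fun s t => sub_ne_zero.2 (hPQ s t)
  -- The loops `P - A` and `Q - B` span a torus, so the winding numbers of its four squares cancel.
  refine boundaryLogChange_diameters_ne_zero hc hinj ?_
  simp only [boundaryLogChange, A, B, Path.source, Path.target, centered_zero, centered_one,
    Complex.ofReal_neg, Complex.ofReal_one, neg_mul, one_mul] at hPB hAQ hPQ ⊢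
  linear_combination hPB + hAQ - hPQ

end LogChange

/-- Every walk of `G` from `a` to `c` meets every walk from `b` to `d`. This is the only trace of
planarity in Kuo condensation: it holds if `a, b, c, d` lie in this order on a face. -/
def WalksMeet {V : Type*} (G : SimpleGraph V) (a b c d : V) : Prop :=
  ∀ (p : G.Walk a c) (q : G.Walk b d), ∃ v ∈ p.support, v ∈ q.support

theorem WalksMeet.anti {V : Type*} {G H : SimpleGraph V} {a b c d : V} (hG : WalksMeet G a b c d)
    (hle : H ≤ G) : WalksMeet H a b c d := fun p q => by
  simpa only [SimpleGraph.Walk.support_mapLe_eq_support] using hG (p.mapLe hle) (q.mapLe hle)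

namespace PlaneDrawing

variable {V : Type*} {G : SimpleGraph V} (D : PlaneDrawing G)

/-- The part of the drawing spanned by the set `S` of vertices. -/
def supportOn (S : Set V) : Set ℂ :=
  D.pt '' S ∪ ⋃ (d : G.Dart) (_ : ∀ v ∈ d.edge, v ∈ S), Set.range (D.arc d)

variable {D}

theorem mem_supportOn_iff {S : Set V} {z : ℂ} : z ∈ D.supportOn S ↔
    (∃ v ∈ S, D.pt v = z) ∨ ∃ (d : G.Dart) (t : unitInterval), (∀ v ∈ d.edge, v ∈ S) ∧
      D.arc d t = z := by
  simp only [supportOn, Set.mem_union, Set.mem_image, Set.mem_iUnion, Set.mem_range, exists_prop,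
    exists_and_left]

theorem supportOn_subset_support (S : Set V) : D.supportOn S ⊆ D.support := by
  intro z hz
  obtain ⟨v, -, rfl⟩ | ⟨d, t, -, rfl⟩ := mem_supportOn_iff.1 hz
  · exact Or.inl ⟨v, rfl⟩
  · exact Or.inr (Set.mem_iUnion.2 ⟨d, t, rfl⟩)

theorem mem_of_pt_mem_supportOn {S : Set V} {v : V} (h : D.pt v ∈ D.supportOn S) : v ∈ S := by
  obtain ⟨u, hu, hpt⟩ | ⟨d, t, hd, hpt⟩ := mem_supportOn_iff.1 h
  · exact D.pt_injective hpt ▸ hu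
  · exact hd v (D.eq_end_of_arc_eq_pt d t v hpt)

theorem disjoint_supportOn {S T : Set V} (h : Disjoint S T) :
    Disjoint (D.supportOn S) (D.supportOn T) := by
  rw [Set.disjoint_left] at h ⊢
  intro z hS hT
  obtain ⟨v, hv, rfl⟩ | ⟨d, t, hd, rfl⟩ := mem_supportOn_iff.1 hS
  · exact h hv (mem_of_pt_mem_supportOn hT)
  obtain ⟨v, hv, hz⟩ | ⟨d', t', hd', hz⟩ := mem_supportOn_iff.1 hT
  · exact h (mem_of_pt_mem_supportOn (hz ▸ hS)) hv
  by_cases hdd' : d.edge = d'.edge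
  · exact h (hd _ (Sym2.mem_mk_left _ _)) (hd' _ (hdd' ▸ Sym2.mem_mk_left _ _))
  · obtain ⟨v, hv, hv', -⟩ := D.eq_pt_of_arc_eq_arc d d' hdd' t t' hz.symm
    exact h (hd v hv) (hd' v hv')

theorem joinedIn_supportOn {S : Set V} {u v : V} (p : G.Walk u v) (hp : ∀ w ∈ p.support, w ∈ S) :
    JoinedIn (D.supportOn S) (D.pt u) (D.pt v) := by
  induction p with
  | nil => exact JoinedIn.refl (mem_supportOn_iff.2 (Or.inl ⟨_, hp _ (by simp), rfl⟩))
  | @cons u v w h p ih =>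
    simp only [SimpleGraph.Walk.support_cons, List.forall_mem_cons] at hp
    let d : G.Dart := ⟨(u, v), h⟩
    have hd : ∀ x ∈ d.edge, x ∈ S :=
      Sym2.forall_mem_pair.2 ⟨hp.1, hp.2 _ p.start_mem_support⟩
    have huv : JoinedIn (D.supportOn S) (D.pt u) (D.pt v) :=
      ⟨D.arc d, fun t => mem_supportOn_iff.2 (Or.inr ⟨d, t, hd, rfl⟩)⟩
    exact huv.trans (ih hp.2)

theorem IsFace.subset_compl_support {F : Set ℂ} (hF : D.IsFace F) : F ⊆ D.supportᶜ := by
  obtain ⟨x, -, rfl⟩ := hF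
  exact connectedComponentIn_subset _ _

theorem walksMeet_of_cyclicOrderOnFace {F : Set ℂ} (hF : D.IsFace F) {a b c d : V}
    (hcyc : D.CyclicOrderOnFace F a b c d) : WalksMeet G a b c d := by
  intro p q
  by_contra! hpq
  obtain ⟨φ, hφ, hinj, ha, hb, hc, hd, hface⟩ := hcyc
  let S : Set V := {v | v ∈ p.support}
  let T : Set V := {v | v ∈ q.support}
  have hdisj := Set.disjoint_left.1 (disjoint_supportOn (D := D) (Set.disjoint_left.2 hpq :
    Disjoint S T))
  have hends : ∀ z ∈ Metric.closedBall 0 1, φ z ∈ D.support →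
      z = 1 ∨ z = Complex.I ∨ z = -1 ∨ z = -Complex.I := by
    intro z hz hφz
    by_contra! hne
    exact hF.subset_compl_support (hface z hz (by simpa using hne)) hφz
  have hac : JoinedIn (D.supportOn S) (φ (-1)) (φ 1) :=
    hc ▸ ha ▸ (joinedIn_supportOn p fun _ => id).symm
  have hbd : JoinedIn (D.supportOn T) (φ (-Complex.I)) (φ Complex.I) :=
    hd ▸ hb ▸ (joinedIn_supportOn q fun _ => id).symm
  have hvertical : ∀ s, ∀ z ∈ Metric.closedBall (0 : ℂ) 1, z.re = 0 → hac.somePath s ≠ φ z := by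
    intro s z hz hre hs
    have hzS : φ z ∈ D.supportOn S := hs ▸ hac.somePath_mem s
    rcases hends z hz (supportOn_subset_support S hzS) with rfl | rfl | rfl | rfl
    · simp at hre
    · exact hdisj hzS hbd.target_mem
    · simp at hre
    · exact hdisj hzS hbd.source_mem
  have hhorizontal : ∀ t, ∀ z ∈ Metric.closedBall (0 : ℂ) 1, z.im = 0 → hbd.somePath t ≠ φ z := by
    intro t z hz him ht
    have hzT : φ z ∈ D.supportOn T := ht ▸ hbd.somePath_mem t
    rcases hends z hz (supportOn_subset_support T hzT) with rfl | rfl | rfl | rfl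
    · exact hdisj hac.target_mem hzT
    · simp at him
    · exact hdisj hac.source_mem hzT
    · simp at him
  obtain ⟨s, t, hst⟩ := exists_eq_of_joins_antipodes hφ hinj _ _ hvertical hhorizontal
  exact hdisj (hac.somePath_mem s) (hst ▸ hbd.somePath_mem t)

theorem nodup_of_cyclicOrderOnFace {F : Set ℂ} {a b c d : V}
    (hcyc : D.CyclicOrderOnFace F a b c d) : [a, b, c, d].Nodup := by
  obtain ⟨φ, -, hinj, ha, hb, hc, hd, -⟩ := hcyc
  have hdistinct : [(1 : ℂ), Complex.I, -1, -Complex.I].Nodup := by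
    norm_num [Complex.ext_iff]
  have hball : ∀ z ∈ [(1 : ℂ), Complex.I, -1, -Complex.I], z ∈ Metric.closedBall 0 1 := by
    simp
  have himage : [(1 : ℂ), Complex.I, -1, -Complex.I].map φ = [a, b, c, d].map D.pt := by
    simp [ha, hb, hc, hd]
  exact .of_map D.pt (himage ▸ hdistinct.map_on fun z hz w hw => hinj (hball z hz) (hball w hw))

end PlaneDrawing

section Superposition

variable {V : Type*} {σ τ : V → V}

/-- The union of the edges `{v, σ v}` and `{v, τ v}`. When `σ` and `τ` exchange the partners in two
matchings, this is the superposition of the matchings, a union of alternating paths and cycles. -/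
def superposition (σ τ : V → V) : SimpleGraph V :=
  SimpleGraph.fromRel fun u v => v = σ u ∨ v = τ u

theorem superposition_comm (σ τ : V → V) : superposition σ τ = superposition τ σ := by
  simp only [superposition, or_comm]

theorem superposition_le {G : SimpleGraph V} (hσ : ∀ v, v ≠ σ v → G.Adj v (σ v))
    (hτ : ∀ v, v ≠ τ v → G.Adj v (τ v)) : superposition σ τ ≤ G := by
  rintro u v ⟨hne, (rfl | rfl) | (rfl | rfl)⟩
  exacts [hσ u hne, hτ u hne, (hσ v hne.symm).symm, (hτ v hne.symm).symm]

theorem reachable_superposition_apply_left (σ τ : V → V) (v : V) :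
    (superposition σ τ).Reachable v (σ v) := by
  by_cases h : v = σ v
  · rw [← h]
  · exact SimpleGraph.Adj.reachable ⟨h, Or.inl (Or.inl rfl)⟩

theorem reachable_superposition_apply_right (σ τ : V → V) (v : V) :
    (superposition σ τ).Reachable v (τ v) :=
  superposition_comm σ τ ▸ reachable_superposition_apply_left τ σ v

theorem mem_of_reachable_superposition (hσ : σ.Involutive) (hτ : τ.Involutive) {S : Set V} {x y : V}
    (hxy : (superposition σ τ).Reachable x y) (hx : x ∈ S) (hSσ : ∀ v ∈ S, σ v ∈ S)
    (hSτ : ∀ v ∈ S, τ v ∈ S) : y ∈ S := by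
  obtain ⟨p⟩ := hxy
  induction p with
  | nil => exact hx
  | cons h p ih =>
    refine ih ?_
    obtain ⟨-, (rfl | rfl) | (h | h)⟩ := h
    · exact hSσ _ hx
    · exact hSτ _ hx
    · rw [← hσ.eq_iff.2 h]
      exact hSσ _ hx
    · rw [← hτ.eq_iff.2 h]
      exact hSτ _ hx

end Superposition

section TwoEnds

variable {V : Type*} {σ τ : Equiv.Perm V} {x : V}

theorem right_apply_mul_zpow_of_involutive (hσ : Function.Involutive σ) (hτ : Function.Involutive τ)
    (hx : τ x = x) (k : ℤ) : τ (((σ * τ) ^ k) x) = ((σ * τ) ^ (-k)) x := by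
  have hσinv : σ⁻¹ = σ := inv_eq_of_mul_eq_one_left (Equiv.ext hσ)
  have hτinv : τ⁻¹ = τ := inv_eq_of_mul_eq_one_left (Equiv.ext hτ)
  have hsemi : SemiconjBy τ (σ * τ) (σ * τ)⁻¹ := by
    rw [SemiconjBy, mul_inv_rev, hσinv, hτinv, mul_assoc]
  simpa only [Equiv.Perm.mul_apply, hx, inv_zpow'] using
    DFunLike.congr_fun (hsemi.zpow_right k).eq x

theorem left_apply_mul_zpow_of_involutive (hσ : Function.Involutive σ) (hτ : Function.Involutive τ)
    (hx : τ x = x) (k : ℤ) : σ (((σ * τ) ^ k) x) = ((σ * τ) ^ (1 - k)) x := by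
  rw [sub_eq_add_neg, zpow_one_add, Equiv.Perm.mul_apply,
    ← right_apply_mul_zpow_of_involutive hσ hτ hx, Equiv.Perm.mul_apply, hτ]

theorem reachable_superposition_iff_sameCycle (hσ : Function.Involutive σ)
    (hτ : Function.Involutive τ) (hx : τ x = x) {y : V} :
    (superposition σ τ).Reachable x y ↔ (σ * τ).SameCycle x y := by
  constructor
  · refine fun h => mem_of_reachable_superposition (S := {y | (σ * τ).SameCycle x y}) hσ hτ h
      (Equiv.Perm.SameCycle.refl _ _) ?_ ?_
    · rintro _ ⟨k, rfl⟩
      exact ⟨1 - k, (left_apply_mul_zpow_of_involutive hσ hτ hx k).symm⟩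
    · rintro _ ⟨k, rfl⟩
      exact ⟨-k, (right_apply_mul_zpow_of_involutive hσ hτ hx k).symm⟩
  · rintro ⟨k, rfl⟩
    have hstep (k : ℤ) :
        (superposition σ τ).Reachable (((σ * τ) ^ k) x) (((σ * τ) ^ (k + 1)) x) := by
      rw [add_comm, zpow_one_add]
      exact (reachable_superposition_apply_right σ τ _).trans
        (reachable_superposition_apply_left σ τ _)
    induction k with
    | zero => rfl
    | succ k ih => exact ih.trans (hstep k)
    | pred k ih => exact ih.trans (by simpa using (hstep (-k - 1)).symm)

theorem perm_zpow_apply_eq_zpow_apply_iff (ρ : Equiv.Perm V) (x : V) (i j : ℤ) :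
    (ρ ^ i) x = (ρ ^ j) x ↔ (Function.minimalPeriod ρ x : ℤ) ∣ i - j := by
  have hdvd : (ρ ^ (i - j)) x = x ↔ (Function.minimalPeriod ρ x : ℤ) ∣ i - j :=
    MulAction.zpow_smul_eq_iff_minimalPeriod_dvd (a := ρ) (b := x)
  rw [← hdvd, sub_eq_neg_add, zpow_add, Equiv.Perm.mul_apply, zpow_neg, Equiv.Perm.inv_eq_iff_eq]

theorem dvd_two_mul_or_dvd_iff (n : ℕ) (k : ℤ) :
    (n : ℤ) ∣ 2 * k ∨ (n : ℤ) ∣ 2 * k - 1 ↔ (n : ℤ) ∣ k ∨ (n : ℤ) ∣ k - ((n + 1) / 2 : ℕ) := by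
  obtain ⟨m, rfl | rfl⟩ := n.even_or_odd'
  · have hm : (2 * m + 1) / 2 = m := by omega
    rw [hm]
    push_cast
    have hodd : ¬ (2 * m : ℤ) ∣ 2 * k - 1 := fun ⟨q, hq⟩ => by
      have : (1 : ℤ) = 2 * (k - m * q) := by linear_combination -hq
      omega
    rw [or_iff_left hodd, mul_dvd_mul_iff_left two_ne_zero]
    constructor
    · rintro ⟨q, rfl⟩
      obtain ⟨r, rfl | rfl⟩ := Int.even_or_odd' q
      · exact Or.inl ⟨r, by ring⟩
      · exact Or.inr ⟨r, by ring⟩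
    · rintro (⟨q, rfl⟩ | ⟨q, hq⟩)
      · exact ⟨2 * q, by ring⟩
      · exact ⟨2 * q + 1, by linear_combination hq⟩
  · have hm : (2 * m + 1 + 1) / 2 = m + 1 := by omega
    have hdouble (j : ℤ) : (2 * m + 1 : ℤ) ∣ 2 * j ↔ (2 * m + 1 : ℤ) ∣ j :=
      ⟨IsCoprime.dvd_of_dvd_mul_left ⟨1, -m, by ring⟩, fun h => h.mul_left 2⟩
    rw [hm]
    push_cast
    rw [hdouble, ← hdouble (k - (m + 1)), ← dvd_sub_self_right (b := 2 * k - 1)]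
    congr! 2
    ring

theorem exists_other_end_of_right [Finite V] (hσ : Function.Involutive σ)
    (hτ : Function.Involutive τ) (hx : τ x = x) (hne : σ x ≠ x) :
    ∃ z ≠ x, (superposition σ τ).Reachable x z ∧
      ∀ y, (superposition σ τ).Reachable x y → (σ y = y ∨ τ y = y ↔ y = x ∨ y = z) := by
  set n := Function.minimalPeriod ⇑(σ * τ) x
  have hpos : 0 < n := Function.minimalPeriod_pos_of_mem_periodicPts
    ((σ * τ).injective.mem_periodicPts x)
  have hn1 : n ≠ 1 := by
    intro h
    have hfix : (σ * τ) x = x := Function.minimalPeriod_eq_one_iff_isFixedPt.1 h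
    rw [Equiv.Perm.mul_apply, hx] at hfix
    exact hne hfix
  have heq_iff (i j : ℤ) : ((σ * τ) ^ i) x = ((σ * τ) ^ j) x ↔ (n : ℤ) ∣ i - j :=
    perm_zpow_apply_eq_zpow_apply_iff (σ * τ) x i j
  have heq_self_iff (k : ℤ) : ((σ * τ) ^ k) x = x ↔ (n : ℤ) ∣ k := by
    rw [← sub_zero k, ← heq_iff, sub_zero, zpow_zero, Equiv.Perm.one_apply]
  have hreach := @reachable_superposition_iff_sameCycle V σ τ x hσ hτ hx
  refine ⟨((σ * τ) ^ (((n + 1) / 2 : ℕ) : ℤ)) x, fun h => ?_, hreach.2 ⟨_, rfl⟩, fun y hy => ?_⟩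
  · have := Nat.le_of_dvd (by omega) (Int.natCast_dvd_natCast.1 ((heq_self_iff _).1 h))
    omega
  · obtain ⟨k, rfl⟩ := hreach.1 hy
    have hσend : σ (((σ * τ) ^ k) x) = ((σ * τ) ^ k) x ↔ (n : ℤ) ∣ 2 * k - 1 := by
      rw [left_apply_mul_zpow_of_involutive hσ hτ hx, heq_iff, ← dvd_neg]
      congr! 1
      ring
    have hτend : τ (((σ * τ) ^ k) x) = ((σ * τ) ^ k) x ↔ (n : ℤ) ∣ 2 * k := by
      rw [right_apply_mul_zpow_of_involutive hσ hτ hx, heq_iff, ← dvd_neg]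
      congr! 1
      ring
    rw [hσend, hτend, heq_self_iff, heq_iff, or_comm, dvd_two_mul_or_dvd_iff]

end TwoEnds

section Ends

variable {V : Type*} [Finite V] {σ τ : V → V}

theorem exists_other_end (hσ : σ.Involutive) (hτ : τ.Involutive) {x : V}
    (hends : σ x = x ∧ τ x ≠ x ∨ τ x = x ∧ σ x ≠ x) :
    ∃ z ≠ x, (superposition σ τ).Reachable x z ∧
      ∀ y, (superposition σ τ).Reachable x y → (σ y = y ∨ τ y = y ↔ y = x ∨ y = z) := by
  rcases hends with ⟨hx, hne⟩ | ⟨hx, hne⟩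
  · simp only [superposition_comm σ τ, or_comm (a := σ _ = _)]
    exact exists_other_end_of_right (σ := hτ.toPerm) (τ := hσ.toPerm) hτ hσ hx hne
  · exact exists_other_end_of_right (σ := hσ.toPerm) (τ := hτ.toPerm) hσ hτ hx hne

theorem not_reachable_of_walksMeet (hσ : σ.Involutive) (hτ : τ.Involutive)
    (hone : ∀ v, σ v = v → τ v ≠ v) {a b c d : V} (hnodup : [a, b, c, d].Nodup)
    (hends : ∀ v, σ v = v ∨ τ v = v ↔ v ∈ [a, b, c, d])
    (hmeet : WalksMeet (superposition σ τ) a b c d) :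
    ¬ (superposition σ τ).Reachable a c := by
  simp only [List.mem_cons, List.not_mem_nil, or_false] at hends
  simp only [List.nodup_cons, List.mem_cons, List.not_mem_nil, or_false, not_or] at hnodup
  have hxor {x : V} (hx : σ x = x ∨ τ x = x) : σ x = x ∧ τ x ≠ x ∨ τ x = x ∧ σ x ≠ x :=
    hx.imp (fun h => ⟨h, hone x h⟩) fun h => ⟨h, fun h' => hone x h' h⟩
  intro hac
  obtain ⟨z, -, -, hz⟩ := exists_other_end hσ hτ (hxor ((hends a).2 (by simp)))
  obtain ⟨w, hwb, hbw, hw⟩ := exists_other_end hσ hτ (hxor ((hends b).2 (by simp)))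
  have hab : ¬ (superposition σ τ).Reachable a b := by
    intro hab
    have hb := (hz b hab).1 ((hends b).2 (by simp))
    have hc := (hz c hac).1 ((hends c).2 (by simp))
    grind
  have hwd : w = d := by
    rcases (hends w).1 ((hw w hbw).2 (Or.inr rfl)) with rfl | rfl | rfl | rfl
    · exact (hab hbw.symm).elim
    · exact (hwb rfl).elim
    · exact (hab (hac.trans hbw.symm)).elim
    · rfl
  obtain ⟨p⟩ := hac
  obtain ⟨q⟩ := hwd ▸ hbw
  obtain ⟨v, hvp, hvq⟩ := hmeet p q
  classical
  exact hab ((p.takeUntil v hvp).reachable.trans (q.takeUntil v hvq).reachable.symm)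

end Ends

section PartnerMap

variable {V : Type*} {G : SimpleGraph V} {A B : Finset V} {σ τ : V → V}

/-- A matching of `G` that misses exactly the vertices in `A`, encoded by the involution `σ` that
exchanges matched vertices and fixes the missed ones. -/
structure IsPartnerMap (G : SimpleGraph V) (A : Finset V) (σ : V → V) : Prop where
  involutive : σ.Involutive
  apply_of_mem : ∀ v ∈ A, σ v = v
  adj : ∀ v ∉ A, G.Adj v (σ v)

namespace IsPartnerMap

theorem apply_eq_self_iff (h : IsPartnerMap G A σ) {v : V} : σ v = v ↔ v ∈ A :=
  ⟨fun hv => by_contra fun hvA => (h.adj v hvA).ne hv.symm, h.apply_of_mem v⟩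

theorem adj_of_ne (h : IsPartnerMap G A σ) {v : V} (hv : v ≠ σ v) : G.Adj v (σ v) :=
  h.adj v fun hvA => hv (h.apply_of_mem v hvA).symm

theorem apply_mem_iff (h : IsPartnerMap G A σ) {v : V} : σ v ∈ A ↔ v ∈ A := by
  rw [← h.apply_eq_self_iff, ← h.apply_eq_self_iff, h.involutive, eq_comm]

theorem unique (hA : IsPartnerMap G A σ) (hB : IsPartnerMap G B σ) : A = B :=
  Finset.ext fun _ => hA.apply_eq_self_iff.symm.trans hB.apply_eq_self_iff

theorem card_modEq [Fintype V] (h : IsPartnerMap G A σ) : Fintype.card V ≡ A.card [MOD 2] := by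
  classical
  let f : Function.End V := σ
  have hsq : f ^ 2 ^ 1 = 1 := funext h.involutive
  have hfix : Fintype.card (Function.fixedPoints σ) = A.card :=
    Fintype.card_of_subtype A fun v => h.apply_eq_self_iff.symm
  rw [← hfix]
  exact Equiv.Perm.card_fixedPoints_modEq hsq

end IsPartnerMap

theorem isPartnerMap_deleteEdges_iff {a b : V} (ha : a ∉ A) :
    IsPartnerMap (G.deleteEdges {s(a, b)}) A σ ↔ IsPartnerMap G A σ ∧ σ a ≠ b := by
  constructor
  · refine fun h => ⟨⟨h.involutive, h.apply_of_mem, fun v hv => ((h.adj v hv).1)⟩, ?_⟩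
    rintro rfl
    simpa using h.adj a ha
  · rintro ⟨h, hab⟩
    refine ⟨h.involutive, h.apply_of_mem, fun v hv => ?_⟩
    have hba : σ b ≠ a := fun hb => hab (h.involutive.eq_iff.1 hb).symm
    rw [SimpleGraph.deleteEdges_adj, Set.mem_singleton_iff, Sym2.eq_iff]
    grind [h.adj v hv]

theorem IsPartnerMap.comp_swap [DecidableEq V] {a b : V} (h : IsPartnerMap G A σ) (hab : σ a = b) :
    IsPartnerMap G (insert a (insert b A)) (σ ∘ Equiv.swap a b) := by
  have hba : σ b = a := hab ▸ h.involutive a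
  have hswap (v : V) : (σ ∘ Equiv.swap a b) v = if v = a then a else if v = b then b else σ v := by
    grind
  refine ⟨fun v => ?_, fun v hv => ?_, fun v hv => ?_⟩
  · grind [h.involutive v]
  · grind [h.apply_of_mem v]
  · grind [h.adj v]

theorem IsPartnerMap.comp_swap_of_insert [DecidableEq V] {a b : V} (hab : G.Adj a b)
    (ha : a ∉ A) (hb : b ∉ A) (h : IsPartnerMap G (insert a (insert b A)) σ) :
    IsPartnerMap G A (σ ∘ Equiv.swap a b) ∧ (σ ∘ Equiv.swap a b) a = b := by
  have hσa : σ a = a := h.apply_of_mem a (by simp)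
  have hσb : σ b = b := h.apply_of_mem b (by simp)
  have hswap (v : V) : (σ ∘ Equiv.swap a b) v = if v = a then b else if v = b then a else σ v := by
    grind
  refine ⟨⟨fun v => ?_, fun v hv => ?_, fun v hv => ?_⟩, by simp [hσb]⟩
  · grind [h.involutive v]
  · grind [h.apply_of_mem v]
  · grind [h.adj v, hab.symm]

/-- The perfect matching encoded by `σ`, as a subgraph. -/
def IsPartnerMap.toSubgraph (h : IsPartnerMap G ∅ σ) : G.Subgraph where
  verts := Set.univ
  Adj u v := σ u = v
  adj_sub := by
    rintro u _ rfl
    exact h.adj u (Finset.notMem_empty u)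
  edge_vert := fun _ => trivial
  symm := ⟨fun _ _ huv => h.involutive.eq_iff.1 huv |>.symm⟩

theorem IsPartnerMap.isPerfectMatching_toSubgraph (h : IsPartnerMap G ∅ σ) :
    h.toSubgraph.IsPerfectMatching :=
  ⟨fun v _ => ⟨σ v, rfl, fun _ => Eq.symm⟩, fun _ => trivial⟩

theorem exists_toSubgraph_eq {P : G.Subgraph} (hP : P.IsPerfectMatching) :
    ∃ (σ : V → V) (h : IsPartnerMap G ∅ σ), h.toSubgraph = P := by
  choose σ hadj hunique using fun v => hP.1 (hP.2 v)
  have hσ : σ.Involutive := fun v => (hunique _ _ (hadj v).symm).symm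
  have h : IsPartnerMap G ∅ σ := ⟨hσ, by simp, fun v _ => (hadj v).adj_sub⟩
  refine ⟨σ, h, SimpleGraph.Subgraph.ext (Set.eq_univ_of_forall hP.2).symm ?_⟩
  funext u v
  refine propext ⟨?_, fun huv => (hunique u v huv).symm⟩
  rintro rfl
  exact hadj u

/-- The extension of a self-map of `S` by the identity. -/
noncomputable def extendById {S : Set V} (ρ : S → S) : V → V :=
  Function.extend Subtype.val (Subtype.val ∘ ρ) id

theorem extendById_coe {S : Set V} (ρ : S → S) (v : S) : extendById ρ v = ρ v :=
  Subtype.val_injective.extend_apply _ _ v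

theorem extendById_of_notMem {S : Set V} (ρ : S → S) {v : V} (hv : v ∉ S) : extendById ρ v = v :=
  Function.extend_apply' _ _ v (by simpa using hv)

theorem extendById_injective (S : Set V) :
    Function.Injective (extendById : (S → S) → V → V) := fun ρ ρ' h => by
  funext v
  rw [← Subtype.coe_inj, ← extendById_coe, ← extendById_coe, h]

theorem isPartnerMap_extendById_iff {ρ : ↥((A : Set V)ᶜ) → ↥((A : Set V)ᶜ)} :
    IsPartnerMap G A (extendById ρ) ↔ IsPartnerMap (G.induce (A : Set V)ᶜ) ∅ ρ := by
  constructor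
  · refine fun h => ⟨fun v => Subtype.ext ?_, by simp, fun v _ => ?_⟩
    · simpa only [extendById_coe] using h.involutive v
    · have hadj := h.adj v v.2
      rwa [extendById_coe] at hadj
  · refine fun h => ⟨fun v => ?_, fun v hv => extendById_of_notMem ρ (by simpa using hv),
      fun v hv => ?_⟩
    · by_cases hv : v ∈ (A : Set V)ᶜ
      · lift v to ↥((A : Set V)ᶜ) using hv
        rw [extendById_coe, extendById_coe, h.involutive]
      · rw [extendById_of_notMem ρ hv, extendById_of_notMem ρ hv]
    · lift v to ↥((A : Set V)ᶜ) using hv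
      rw [extendById_coe]
      exact h.adj v (Finset.notMem_empty v)

theorem IsPartnerMap.exists_extendById_eq (h : IsPartnerMap G A σ) :
    ∃ ρ : ↥((A : Set V)ᶜ) → ↥((A : Set V)ᶜ), extendById ρ = σ := by
  have hmaps : Set.MapsTo σ (A : Set V)ᶜ (A : Set V)ᶜ := fun v => mt h.apply_mem_iff.1
  refine ⟨hmaps.restrict, funext fun v => ?_⟩
  by_cases hv : v ∈ (A : Set V)ᶜ
  · exact extendById_coe _ ⟨v, hv⟩
  · rw [extendById_of_notMem _ hv, h.apply_of_mem v (by simpa using hv)]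

/-- The finite set of the matchings of `G` that miss exactly the vertices in `A`. -/
noncomputable def partnerMaps [Finite V] (G : SimpleGraph V) (A : Finset V) : Finset (V → V) :=
  (Set.toFinite {σ | IsPartnerMap G A σ}).toFinset

@[simp]
theorem mem_partnerMaps [Finite V] : σ ∈ partnerMaps G A ↔ IsPartnerMap G A σ := by
  simp [partnerMaps]

end PartnerMap

section Splice

variable {V : Type*} {G : SimpleGraph V} {A B : Finset V} {σ τ : V → V} {a v : V}

open Classical in
/-- The map that agrees with `σ` on the component of `a` in the superposition of `σ` and `τ`, and
with `τ` elsewhere. -/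
noncomputable def splice (a : V) (σ τ : V → V) : V → V :=
  fun v => if (superposition σ τ).Reachable a v then σ v else τ v

theorem splice_of_reachable (h : (superposition σ τ).Reachable a v) : splice a σ τ v = σ v :=
  if_pos h

theorem splice_of_not_reachable (h : ¬ (superposition σ τ).Reachable a v) :
    splice a σ τ v = τ v :=
  if_neg h

theorem splice_swap_of_reachable (h : (superposition σ τ).Reachable a v) :
    splice a τ σ v = τ v :=
  if_pos (superposition_comm σ τ ▸ h)

theorem splice_swap_of_not_reachable (h : ¬ (superposition σ τ).Reachable a v) :
    splice a τ σ v = σ v :=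
  if_neg (superposition_comm σ τ ▸ h)

theorem splice_and_splice_swap (a : V) (σ τ : V → V) (v : V) :
    splice a σ τ v = σ v ∧ splice a τ σ v = τ v ∨ splice a σ τ v = τ v ∧ splice a τ σ v = σ v := by
  by_cases h : (superposition σ τ).Reachable a v
  · exact Or.inl ⟨splice_of_reachable h, splice_swap_of_reachable h⟩
  · exact Or.inr ⟨splice_of_not_reachable h, splice_swap_of_not_reachable h⟩

theorem superposition_splice (a : V) (σ τ : V → V) :
    superposition (splice a σ τ) (splice a τ σ) = superposition σ τ := by
  have hpair (u v : V) : v = splice a σ τ u ∨ v = splice a τ σ u ↔ v = σ u ∨ v = τ u := by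
    grind [splice_and_splice_swap a σ τ u]
  simp only [superposition, hpair]

theorem splice_splice (a : V) (σ τ : V → V) :
    splice a (splice a σ τ) (splice a τ σ) = σ := by
  funext v
  by_cases h : (superposition σ τ).Reachable a v
  · rw [splice_of_reachable (by rwa [superposition_splice]), splice_of_reachable h]
  · rw [splice_of_not_reachable (by rwa [superposition_splice]), splice_swap_of_not_reachable h]

theorem involutive_splice (hσ : σ.Involutive) (hτ : τ.Involutive) (a : V) :
    (splice a σ τ).Involutive := by
  intro v
  by_cases h : (superposition σ τ).Reachable a v
  · rw [splice_of_reachable h,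
      splice_of_reachable (h.trans (reachable_superposition_apply_left σ τ v)), hσ]
  · have hτv : ¬ (superposition σ τ).Reachable a (τ v) := fun h' =>
      h (h'.trans (reachable_superposition_apply_right σ τ v).symm)
    rw [splice_of_not_reachable h, splice_of_not_reachable hτv, hτ]

open Classical in
/-- The vertices missed by the spliced matching `splice a σ τ`, when `σ` misses `A` and `τ`
misses `B`. -/
noncomputable def spliceEnds (a : V) (σ τ : V → V) (A B : Finset V) : Finset V :=
  {v ∈ A | (superposition σ τ).Reachable a v} ∪ {v ∈ B | ¬ (superposition σ τ).Reachable a v}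

theorem mem_spliceEnds_of_reachable (h : (superposition σ τ).Reachable a v) :
    v ∈ spliceEnds a σ τ A B ↔ v ∈ A := by
  simp [spliceEnds, h]

theorem mem_spliceEnds_of_not_reachable (h : ¬ (superposition σ τ).Reachable a v) :
    v ∈ spliceEnds a σ τ A B ↔ v ∈ B := by
  simp [spliceEnds, h]

theorem sdiff_spliceEnds [DecidableEq V] {T : Finset V} (hA : A ⊆ T) :
    T \ spliceEnds a σ τ A (T \ A) = spliceEnds a τ σ (T \ A) A := by
  ext v
  rw [Finset.mem_sdiff]
  by_cases h : (superposition σ τ).Reachable a v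
  · rw [mem_spliceEnds_of_reachable h, mem_spliceEnds_of_reachable (superposition_comm σ τ ▸ h),
      Finset.mem_sdiff]
  · rw [mem_spliceEnds_of_not_reachable h,
      mem_spliceEnds_of_not_reachable (superposition_comm σ τ ▸ h), Finset.mem_sdiff]
    grind

theorem spliceEnds_subset_erase [DecidableEq V] {T : Finset V} (hA : A ⊆ T.erase a) (hB : B ⊆ T) :
    spliceEnds a σ τ A B ⊆ T.erase a := by
  intro v hv
  by_cases h : (superposition σ τ).Reachable a v
  · exact hA ((mem_spliceEnds_of_reachable h).1 hv)
  · exact Finset.mem_erase.2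
      ⟨fun hva => h (hva ▸ .rfl), hB ((mem_spliceEnds_of_not_reachable h).1 hv)⟩

theorem IsPartnerMap.splice (hσ : IsPartnerMap G A σ) (hτ : IsPartnerMap G B τ) (a : V) :
    IsPartnerMap G (spliceEnds a σ τ A B) (splice a σ τ) := by
  refine ⟨involutive_splice hσ.involutive hτ.involutive a, fun v hv => ?_, fun v hv => ?_⟩ <;>
    by_cases h : (superposition σ τ).Reachable a v
  · rw [splice_of_reachable h, hσ.apply_of_mem v ((mem_spliceEnds_of_reachable h).1 hv)]
  · rw [splice_of_not_reachable h, hτ.apply_of_mem v ((mem_spliceEnds_of_not_reachable h).1 hv)]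
  · rw [splice_of_reachable h]
    exact hσ.adj v (mt (mem_spliceEnds_of_reachable h).2 hv)
  · rw [splice_of_not_reachable h]
    exact hτ.adj v (mt (mem_spliceEnds_of_not_reachable h).2 hv)

end Splice

namespace WeightedGraph

variable {V R : Type*} [Fintype V] [LinearOrder V] [CommRing R] {A : Finset V} {a b c d : V}

/-- The weight of the matching encoded by the involution `σ`. The order on the vertices serves to
count every edge `{v, σ v}` once. -/
def partnerWeight (G : WeightedGraph V R) (σ : V → V) : R :=
  ∏ v with v < σ v, G.weight s(v, σ v)

/-- `M(G - A)`, as a sum over the matchings of `G` that miss exactly the vertices in `A`. -/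
noncomputable def matchingSum (G : WeightedGraph V R) (A : Finset V) : R :=
  ∑ σ ∈ partnerMaps G.graph A, G.partnerWeight σ

theorem partnerWeight_eq_mul_comp_swap (G : WeightedGraph V R) {σ : V → V} (hne : a ≠ b)
    (hab : σ a = b) (hba : σ b = a) :
    G.partnerWeight σ = G.weight s(a, b) * G.partnerWeight (σ ∘ Equiv.swap a b) := by
  wlog hlt : a < b generalizing a b
  · rw [Sym2.eq_swap, Equiv.swap_comm]
    exact this hne.symm hba hab (hne.lt_or_gt.resolve_left hlt)
  have hedges : Finset.univ.filter (fun v => v < σ v) = insert a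
      (Finset.univ.filter fun v => v < (σ ∘ Equiv.swap a b) v) := by
    ext v
    simp only [Finset.mem_filter_univ, Finset.mem_insert, Function.comp_apply]
    grind
  rw [partnerWeight, hedges, Finset.prod_insert (by simp [hba]), hab, partnerWeight]
  congr 1
  refine Finset.prod_congr rfl fun v hv => ?_
  simp only [Finset.mem_filter_univ, Function.comp_apply] at hv
  have hv' : Equiv.swap a b v = v := Equiv.swap_apply_of_ne_of_ne (by grind) (by grind)
  rw [Function.comp_apply, hv']

theorem matchingSum_eq_add_matchingSum_insert (G : WeightedGraph V R) (hab : G.graph.Adj a b)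
    (ha : a ∉ A) (hb : b ∉ A) :
    G.matchingSum A = (G.deleteEdges {s(a, b)}).matchingSum A
      + G.weight s(a, b) * G.matchingSum (insert a (insert b A)) := by
  rw [matchingSum, ← Finset.sum_filter_not_add_sum_filter _ fun σ => σ a = b]
  congr 1
  · refine Finset.sum_congr (Finset.ext fun σ => ?_) fun _ _ => rfl
    simp [deleteEdges, isPartnerMap_deleteEdges_iff ha]
  · rw [matchingSum, Finset.mul_sum]
    refine Finset.sum_bij' (fun σ _ => σ ∘ Equiv.swap a b) (fun σ _ => σ ∘ Equiv.swap a b)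
      ?_ ?_ ?_ ?_ ?_ <;> simp only [Finset.mem_filter, mem_partnerMaps]
    · exact fun σ hσ => hσ.1.comp_swap hσ.2
    · exact fun σ hσ => IsPartnerMap.comp_swap_of_insert hab ha hb hσ
    · exact fun σ _ => by simp [Function.comp_assoc, ← Equiv.coe_trans]
    · exact fun σ _ => by simp [Function.comp_assoc, ← Equiv.coe_trans]
    · rintro σ ⟨hσ, rfl⟩
      exact G.partnerWeight_eq_mul_comp_swap hab.ne rfl (hσ.involutive a)

theorem matchingSum_eq_zero (G : WeightedGraph V R)
    (hA : ¬ Fintype.card V ≡ A.card [MOD 2]) : G.matchingSum A = 0 :=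
  Finset.sum_eq_zero fun _ hσ => absurd (mem_partnerMaps.1 hσ).card_modEq hA

theorem partnerWeight_splice_mul (G : WeightedGraph V R) (a : V) (σ τ : V → V) :
    G.partnerWeight (splice a σ τ) * G.partnerWeight (splice a τ σ)
      = G.partnerWeight σ * G.partnerWeight τ := by
  simp only [partnerWeight, Finset.prod_filter, ← Finset.prod_mul_distrib]
  refine Finset.prod_congr rfl fun v _ => ?_
  rcases splice_and_splice_swap a σ τ v with ⟨h, h'⟩ | ⟨h, h'⟩
  · rw [h, h']
  · rw [h, h', mul_comm]

/-- Exchanging the two matchings outside the component of `a` in their superposition reverses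
signs, because `c` lies outside this component. -/
theorem sum_powerset_matchingSum_mul_eq_zero (G : WeightedGraph V R) {T : Finset V} (hc : c ∈ T)
    (hac : ∀ A ⊆ T.erase a, ∀ σ τ, IsPartnerMap G.graph A σ → IsPartnerMap G.graph (T \ A) τ →
      ¬ (superposition σ τ).Reachable a c) :
    ∑ A ∈ (T.erase a).powerset,
      (if c ∈ A then -1 else 1) * (G.matchingSum A * G.matchingSum (T \ A)) = 0 := by
  simp only [matchingSum, Finset.sum_mul_sum, ← Finset.sum_product']
  simp only [Finset.mul_sum, Finset.sum_sigma']
  have hsign {A : Finset V} {σ τ : V → V} (hA : A ⊆ T.erase a) (hσ : IsPartnerMap G.graph A σ)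
      (hτ : IsPartnerMap G.graph (T \ A) τ) : c ∈ spliceEnds a σ τ A (T \ A) ↔ c ∉ A := by
    rw [mem_spliceEnds_of_not_reachable (hac A hA σ τ hσ hτ), Finset.mem_sdiff, and_iff_right hc]
  refine Finset.sum_involution (fun p _ => ⟨spliceEnds a p.2.1 p.2.2 p.1 (T \ p.1),
    splice a p.2.1 p.2.2, splice a p.2.2 p.2.1⟩) ?_ ?_ ?_ ?_ <;>
    simp only [Sigma.forall, Prod.forall, Finset.mem_sigma, Finset.mem_powerset,
      Finset.mem_product, mem_partnerMaps] <;>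
    rintro A σ τ ⟨hA, hσ, hτ⟩
  · rw [partnerWeight_splice_mul]
    simp only [hsign hA hσ hτ]
    by_cases h : c ∈ A <;> simp [h]
  · intro _ heq
    have hfix : spliceEnds a σ τ A (T \ A) = A := congrArg Sigma.fst heq
    exact iff_not_self (hfix ▸ hsign hA hσ hτ)
  · have hAT : A ⊆ T := hA.trans (Finset.erase_subset a T)
    exact ⟨spliceEnds_subset_erase hA Finset.sdiff_subset, hσ.splice hτ a,
      sdiff_spliceEnds hAT ▸ hτ.splice hσ a⟩
  · have hAT : A ⊆ T := hA.trans (Finset.erase_subset a T)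
    have hback := (hσ.splice hτ a).splice (sdiff_spliceEnds hAT ▸ hτ.splice hσ a) a
    simp only [splice_splice] at hback ⊢
    rw [hback.unique hσ]

theorem sum_powerset_matchingSum_mul_eq_zero_of_walksMeet (G : WeightedGraph V R)
    (hnodup : [a, b, c, d].Nodup) (hmeet : WalksMeet G.graph a b c d) :
    ∑ A ∈ (({a, b, c, d} : Finset V).erase a).powerset,
      (if c ∈ A then -1 else 1) * (G.matchingSum A * G.matchingSum ({a, b, c, d} \ A)) = 0 := by
  refine G.sum_powerset_matchingSum_mul_eq_zero (by simp) fun A hA σ τ hσ hτ => ?_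
  have hle : superposition σ τ ≤ G.graph :=
    superposition_le (fun _ => hσ.adj_of_ne) fun _ => hτ.adj_of_ne
  have hsub : A ⊆ {a, b, c, d} := hA.trans (Finset.erase_subset _ _)
  refine not_reachable_of_walksMeet hσ.involutive hτ.involutive (fun v hσv hτv => ?_) hnodup
    (fun v => ?_) (hmeet.anti hle)
  · exact (Finset.mem_sdiff.1 (hτ.apply_eq_self_iff.1 hτv)).2 (hσ.apply_eq_self_iff.1 hσv)
  · rw [hσ.apply_eq_self_iff, hτ.apply_eq_self_iff, ← Finset.mem_union,
      Finset.union_sdiff_of_subset hsub]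
    simp

/-- Kuo's graphical condensation. -/
theorem matchingSum_condensation (G : WeightedGraph V R) (hnodup : [a, b, c, d].Nodup)
    (hmeet : WalksMeet G.graph a b c d) :
    G.matchingSum ∅ * G.matchingSum {a, b, c, d} + G.matchingSum {b, d} * G.matchingSum {a, c}
      = G.matchingSum {c, d} * G.matchingSum {a, b}
        + G.matchingSum {b, c} * G.matchingSum {a, d} := by
  have hsum := G.sum_powerset_matchingSum_mul_eq_zero_of_walksMeet hnodup hmeet
  simp only [List.nodup_cons, List.mem_cons, List.not_mem_nil, or_false, not_or] at hnodup
  obtain ⟨⟨hab, hac, had⟩, ⟨hbc, hbd⟩, hcd, -⟩ := hnodup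
  have hcard {A : Finset V} {n : ℕ} (hA : A.card = n) (hn : ¬ Fintype.card V ≡ n [MOD 2]) :
      G.matchingSum A = 0 := G.matchingSum_eq_zero (hA ▸ hn)
  by_cases hV : Fintype.card V ≡ 0 [MOD 2]
  · have hone (v : V) : G.matchingSum {v} = 0 :=
      hcard (Finset.card_singleton v) fun h => absurd (hV.symm.trans h) (by decide)
    have hthree : G.matchingSum {b, c, d} = 0 :=
      hcard (Finset.card_eq_three.2 ⟨b, c, d, hbc, hbd, hcd, rfl⟩) fun h =>
        absurd (hV.symm.trans h) (by decide)
    have hbd' : ({a, b, c, d} : Finset V) \ {b, d} = {a, c} := by grind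
    have hcd' : ({a, b, c, d} : Finset V) \ {c, d} = {a, b} := by grind
    have hbc' : ({a, b, c, d} : Finset V) \ {b, c} = {a, d} := by grind
    have hpow : ({d} : Finset V).powerset = {∅, {d}} := rfl
    have hne : (∅ : Finset V) ≠ {d} := (Finset.singleton_ne_empty d).symm
    rw [Finset.erase_insert (by simp [hab, hac, had]),
      Finset.sum_powerset_insert (by simp [hbc, hbd]), Finset.sum_powerset_insert (by simpa),
      Finset.sum_powerset_insert (by simpa), hpow] at hsum
    simp only [Finset.sum_pair hne] at hsum
    simp only [Finset.notMem_empty, if_false, if_true, Finset.sdiff_empty, Finset.mem_singleton,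
      hcd, hone, zero_mul, mul_zero, add_zero, insert_empty_eq, Finset.mem_insert, or_false, hcd',
      neg_mul, one_mul, zero_add, Ne.symm hbc, or_self, hbd', or_true, hbc', hthree] at hsum
    linear_combination hsum
  · have hempty : G.matchingSum ∅ = 0 := hcard Finset.card_empty hV
    have hpair {u v : V} (huv : u ≠ v) : G.matchingSum {u, v} = 0 :=
      hcard (Finset.card_pair huv) hV
    rw [hempty, hpair hbd, hpair hcd, hpair hbc]
    ring

theorem weightOf_toSubgraph (G : WeightedGraph V R) {σ : V → V} (h : IsPartnerMap G.graph ∅ σ) :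
    G.weightOf h.toSubgraph.edgeSet = G.partnerWeight σ := by
  have hedges : h.toSubgraph.edgeSet = (fun v => s(v, σ v)) '' {v | v < σ v} := by
    ext e
    induction e with | _ x y
    simp only [SimpleGraph.Subgraph.mem_edgeSet, Set.mem_image, Set.mem_ofPred_eq, Sym2.eq_iff]
    constructor
    · rintro rfl
      rcases (h.adj x (Finset.notMem_empty x)).ne.lt_or_gt with hlt | hlt
      · exact ⟨x, hlt, Or.inl ⟨rfl, rfl⟩⟩
      · exact ⟨σ x, by rwa [h.involutive], Or.inr ⟨rfl, h.involutive x⟩⟩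
    · rintro ⟨v, -, ⟨rfl, rfl⟩ | ⟨rfl, rfl⟩⟩
      · rfl
      · exact h.involutive v
  have hinj : Set.InjOn (fun v => s(v, σ v)) {v | v < σ v} := by
    intro u hu v hv huv
    rcases Sym2.eq_iff.1 huv with ⟨heq, -⟩ | ⟨huv, hvu⟩
    · exact heq
    · have hlt : u < σ u := hu
      rw [hvu, huv] at hlt
      exact absurd hlt (lt_asymm hv)
  rw [weightOf, hedges, finprod_mem_image hinj, partnerWeight]
  exact finprod_mem_eq_prod_of_inter_mulSupport_eq _ (by simp)

theorem M_eq_matchingSum (G : WeightedGraph V R) : G.M = G.matchingSum ∅ := by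
  rw [matchingSum, ← Finset.sum_coe_sort, ← finsum_eq_sum_of_fintype, M]
  let e (σ : partnerMaps G.graph ∅) : {P : G.graph.Subgraph // P.IsPerfectMatching} :=
    ⟨(mem_partnerMaps.1 σ.2).toSubgraph, (mem_partnerMaps.1 σ.2).isPerfectMatching_toSubgraph⟩
  refine (finsum_eq_of_bijective e ⟨fun σ τ h => ?_, fun P => ?_⟩ fun σ =>
    (G.weightOf_toSubgraph (mem_partnerMaps.1 σ.2)).symm).symm
  · have hadj : (e σ).1.Adj = (e τ).1.Adj := by rw [h]
    refine Subtype.ext (funext fun v => ?_)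
    have hτv : (e τ).1.Adj v (σ.1 v) := hadj ▸ rfl
    exact Eq.symm hτv
  · obtain ⟨σ, hσ, hP⟩ := exists_toSubgraph_eq P.2
    exact ⟨⟨σ, mem_partnerMaps.2 hσ⟩, Subtype.ext hP⟩

theorem partnerWeight_extendById (G : WeightedGraph V R) {S : Set V} [Fintype ↥Sᶜ]
    (ρ : ↥Sᶜ → ↥Sᶜ) : G.partnerWeight (extendById ρ) = (G.deleteVerts S).partnerWeight ρ := by
  symm
  refine Finset.prod_nbij Subtype.val (fun v hv => ?_) Subtype.val_injective.injOn
    (fun v hv => ?_) fun v _ => ?_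
  · rw [Finset.mem_filter_univ] at hv ⊢
    rwa [extendById_coe, Subtype.coe_lt_coe]
  · have hlt : v < extendById ρ v := by simpa using hv
    have hvS : v ∈ Sᶜ := by_contra fun hvS => hlt.ne (extendById_of_notMem ρ hvS).symm
    lift v to ↥Sᶜ using hvS
    rw [extendById_coe, Subtype.coe_lt_coe] at hlt
    exact ⟨v, by simpa using hlt, rfl⟩
  · rw [extendById_coe]
    rfl

theorem M_deleteVerts_eq_matchingSum (G : WeightedGraph V R) (A : Finset V) :
    (G.deleteVerts (A : Set V)).M = G.matchingSum A := by
  rw [M_eq_matchingSum]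
  refine Finset.sum_nbij extendById (fun ρ hρ => ?_) (extendById_injective _).injOn
    (fun σ hσ => ?_) fun ρ _ => (G.partnerWeight_extendById ρ).symm
  · exact mem_partnerMaps.2 (isPartnerMap_extendById_iff.2 (mem_partnerMaps.1 hρ))
  · have hσ' : IsPartnerMap G.graph A σ := mem_partnerMaps.1 hσ
    obtain ⟨ρ, rfl⟩ := hσ'.exists_extendById_eq
    exact ⟨ρ, mem_partnerMaps.2 (isPartnerMap_extendById_iff.1 hσ'), rfl⟩

end WeightedGraph

theorem theorem3p6_general {V : Type*} [Finite V] {R : Type*} [CommRing R]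
    (G : WeightedGraph V R) {a₁ b₁ a₂ b₂ : V} (hnodup : [a₁, b₁, a₂, b₂].Nodup)
    (hmeet : WalksMeet G.graph a₁ b₁ a₂ b₂) (he : G.graph.Adj a₂ b₂) :
    G.M * ((G.deleteEdges {s(a₂, b₂)}).deleteVerts {a₁, b₁}).M =
      (G.deleteVerts {a₁, b₁}).M * (G.deleteEdges {s(a₂, b₂)}).M
        + G.weight s(a₂, b₂) * (G.deleteVerts {a₁, a₂}).M * (G.deleteVerts {b₁, b₂}).M
        - G.weight s(a₂, b₂) * (G.deleteVerts {a₁, b₂}).M * (G.deleteVerts {a₂, b₁}).M := by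
  have := Fintype.ofFinite V
  let _ : LinearOrder V := LinearOrder.lift' (Fintype.equivFin V) (Fintype.equivFin V).injective
  have hdelete (H : WeightedGraph V R) (u v : V) :
      (H.deleteVerts {u, v}).M = H.matchingSum {u, v} := by
    rw [← H.M_deleteVerts_eq_matchingSum, Finset.coe_pair]
  have kuo := G.matchingSum_condensation hnodup hmeet
  have split := G.matchingSum_eq_add_matchingSum_insert (A := ∅) he (by simp) (by simp)
  have split' := G.matchingSum_eq_add_matchingSum_insert (A := {a₁, b₁}) he (by grind) (by grind)
  have hfour : (insert a₂ (insert b₂ {a₁, b₁}) : Finset V) = {a₁, b₁, a₂, b₂} := by grind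
  rw [insert_empty_eq] at split
  rw [hfour] at split'
  simp only [hdelete, WeightedGraph.M_eq_matchingSum, Finset.pair_comm a₂ b₁]
  linear_combination G.matchingSum {a₁, b₁} * split - G.matchingSum ∅ * split'
    - G.weight s(a₂, b₂) * kuo

theorem theorem3p6 {V : Type*} [Fintype V] {R : Type*} [CommRing R]
    (G : WeightedGraph V R) (heven : Even (Fintype.card V))
    (D : PlaneDrawing G.graph) (F : Set ℂ) (hF : D.IsFace F)
    (a₁ b₁ a₂ b₂ : V) (he : G.graph.Adj a₂ b₂)
    (hcyc : D.CyclicOrderOnFace F a₁ b₁ a₂ b₂) :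
    G.M * ((G.deleteEdges {s(a₂, b₂)}).deleteVerts {a₁, b₁}).M =
      (G.deleteVerts {a₁, b₁}).M * (G.deleteEdges {s(a₂, b₂)}).M
        + G.weight s(a₂, b₂) * (G.deleteVerts {a₁, a₂}).M * (G.deleteVerts {b₁, b₂}).M
        - G.weight s(a₂, b₂) * (G.deleteVerts {a₁, b₂}).M * (G.deleteVerts {a₂, b₁}).M := by
  exact theorem3p6_general G (PlaneDrawing.nodup_of_cyclicOrderOnFace hcyc)
    (PlaneDrawing.walksMeet_of_cyclicOrderOnFace hF hcyc) he
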